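/- The Fibonacci polynomials are defined by $F_0(x)=0$, $F_1(x)=1$ and $F_m(x)=xF_{m-1}(x)+F_{m-2}(x)$ for $m\ge 2$. For a nonnegative integer $q$ with binary expansion $q=\sum_{i\ge 0}c_i2^i$ ($c_i\in\{0,1\}$, with $c_i=0$ beyond the leading digit) put $t(q)=\min\{i\ge 0: c_i=c_{i+1}\}$. For a map $f:\mathbb{Z}_p\to\mathbb{Z}_p$, a minimal decomposition is a partition $\mathbb{Z}_p=\mathcal P\sqcup\bigsqcup_i\mathcal M_i\sqcup\mathcal B$ in which $\mathcal P$ is the set of all periodic points of $f$ and is finite; the minimal components $\mathcal M_i$, at most countably many, are clopen, nonempty, $f$-invariant, finite unions of balls, and each subsystem $f:\mathcal M_i\to\mathcal M_i$ is minimal (every orbit is dense in $\mathcal M_i$); and each point of $\mathcal B$ lies in the attracting basin of a periodic orbit or of some $\mathcal M_i$. **Theorem.** Let $q\ge 0$ be an even integer, $m=10+12q$ and $t=t(q)$. Then $0$ is a fixed point of $F_m$, and the minimal decomposition of $\mathbb{Z}_2$ for $F_m$ is $$\mathbb{Z}_2=\{0\}\sqcup\Bigl(\bigsqcup_{k=0}^{3}A_k\;\sqcup\;\bigsqcup_{n\ge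 1}\bigsqcup_{k=0}^{2^{t+1}-1}M_{n,k}\Bigr),$$ where $$A_k=(1+4k+2^4\mathbb{Z}_2)\cup(7-4k+2^4\mathbb{Z}_2),\qquad M_{n,k}=(1+2k)2^n+2^{n+t+2}\mathbb{Z}_2 .$$ Here $\mathcal P=\{0\}$, the sets $A_k$ and $M_{n,k}$ (for the indices above) are pairwise disjoint and are the minimal components, and $\mathcal B=\emptyset$. -/

import Mathlib

/-- The Fibonacci polynomials: `F_0 = 0`, `F_1 = 1`, `F_m = x F_{m-1} + F_{m-2}`. -/
noncomputable def fibPoly (R : Type*) [CommRing R] : ℕ → Polynomial R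
  | 0 => 0
  | 1 => 1
  | m + 2 => Polynomial.X * fibPoly R (m + 1) + fibPoly R m

/-- The binary digits of `q` (with `c_i = 0` beyond the leading digit) contain two consecutive
equal digits. -/
theorem exists_testBit_eq_succ (q : ℕ) : ∃ i : ℕ, q.testBit i = q.testBit (i + 1) := by
  refine ⟨q, ?_⟩
  have h1 : q < 2 ^ q := Nat.lt_two_pow_self
  have h2 : q < 2 ^ (q + 1) := h1.trans (Nat.pow_lt_pow_right (by norm_num) (Nat.lt_succ_self q))
  rw [Nat.testBit_lt_two_pow h1, Nat.testBit_lt_two_pow h2]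

/-- `t(q) = min {i ≥ 0 | c_i = c_{i+1}}`, where `q = c_0 + c_1 2 + c_2 2^2 + ⋯` in binary. -/
def tIndex (q : ℕ) : ℕ := Nat.find (exists_testBit_eq_succ q)

/-- The ball `a + p^l ℤ_p`. -/
def padicBall (p : ℕ) [Fact p.Prime] (a : ℤ_[p]) (l : ℕ) : Set ℤ_[p] :=
  {x | ∃ y : ℤ_[p], x = a + (p : ℤ_[p]) ^ l * y}

/-- The set `S` is a union of finitely many balls of `ℤ_p`. -/
def IsFiniteUnionOfBalls (p : ℕ) [Fact p.Prime] (S : Set ℤ_[p]) : Prop :=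
  ∃ T : Finset (ℤ_[p] × ℕ), S = ⋃ b ∈ T, padicBall p b.1 b.2

/-- `f : S → S` is a minimal subsystem: `S` is nonempty and invariant, and the orbit of every
point of `S` is dense in `S`. -/
def IsMinimalSubsystem {X : Type*} [TopologicalSpace X] (f : X → X) (S : Set X) : Prop :=
  S.Nonempty ∧ Set.MapsTo f S S ∧ ∀ x ∈ S, S ⊆ closure (Set.range fun n : ℕ => f^[n] x)

/-- The attracting basin of a set `A`: the points whose forward orbit approaches `A`. -/
def attractingBasin {X : Type*} [PseudoMetricSpace X] (f : X → X) (A : Set X) : Set X :=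
  {x | Filter.Tendsto (fun n : ℕ => Metric.infDist (f^[n] x) A) Filter.atTop (nhds 0)}

/-- `ℤ_p = P ⊔ (⨆ i, M i) ⊔ B` is the minimal decomposition for the map `f`, with minimal
components `M i`. -/
structure IsMinimalDecomposition (p : ℕ) [Fact p.Prime] (f : ℤ_[p] → ℤ_[p])
    (P : Set ℤ_[p]) {ι : Type*} (M : ι → Set ℤ_[p]) (B : Set ℤ_[p]) : Prop where
  /-- `P` is the set of all periodic points of `f`, and it is finite. -/
  finite_P : P.Finite
  P_eq : P = Function.periodicPts f
  /-- There are at most countably many components. -/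
  countable : Countable ι
  /-- Each component is clopen, a finite union of balls, and a minimal subsystem. -/
  isClopen : ∀ i, IsClopen (M i)
  isFiniteUnionOfBalls : ∀ i, IsFiniteUnionOfBalls p (M i)
  isMinimalSubsystem : ∀ i, IsMinimalSubsystem f (M i)
  /-- Every point of `B` is attracted by a periodic orbit or by a minimal component. -/
  basin : ∀ x ∈ B,
    (∃ y ∈ P, x ∈ attractingBasin f (Set.range fun n : ℕ => f^[n] y)) ∨
      ∃ i, x ∈ attractingBasin f (M i)
  /-- The pieces are pairwise disjoint and cover `ℤ_p`. -/
  disjoint_M : Pairwise fun i j => Disjoint (M i) (M j)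
  disjoint_P_M : ∀ i, Disjoint P (M i)
  disjoint_P_B : Disjoint P B
  disjoint_M_B : ∀ i, Disjoint (M i) B
  union_eq : P ∪ (⋃ i, M i) ∪ B = Set.univ

/-- `A_k = (1 + 4k + 2^4 ℤ_2) ∪ (7 - 4k + 2^4 ℤ_2)`. -/
def componentA (k : ℕ) : Set ℤ_[2] :=
  padicBall 2 (1 + 4 * (k : ℤ_[2])) 4 ∪ padicBall 2 (7 - 4 * (k : ℤ_[2])) 4

/-- `M_{n,k} = (1 + 2k) 2^n + 2^{n+t+2} ℤ_2`. -/
def componentM (t n k : ℕ) : Set ℤ_[2] :=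
  padicBall 2 ((1 + 2 * (k : ℤ_[2])) * 2 ^ n) (n + t + 2)

/-! A map is minimal on a ball `a + 2^l ℤ_2` once it moves every point by `2^l` times a unit and its
difference quotients are 1 mod 4: the `2^j`-th iterate then moves every point by exactly `2^(l+j)`
times a unit, so every orbit reaches all residues of the ball (`iterate_two_pow_shift`,
`exists_iterate_congr`). On even `x`, write `F_{2n}(x) = x S_n(x^2+2)` and `m = 2(2N+1)` with `N =
3q+2`. Doubling formulas and the fact that `N` has valuation `t+1` give `F_m(x) = x + 2^(t+2) x u`
with `u` odd (`eval_fibPoly_of_even`). A point of valuation `n` is therefore displaced by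
`2^(n+t+2)` times a unit, which dictates the radius of `M_{n,k}`. On odd `x`, finite computations
give `F_m(x) ≡ 8 - x` mod 16, `F_m(F_m(x)) ≡ x + 16` mod 32 and `(F_m ∘ F_m)' ≡ 1` mod 4. Thus `F_m`
swaps the two balls of `A_k`, and the criterion applies to its square. These components cover
everything except 0, and none contains a periodic point, since its orbit would be finite yet dense
in an infinite set. -/

/-! ### Balls of `ℤ_p` and a minimality criterion over `ℤ_2`. -/

section Dynamics

theorem mem_padicBall_iff {p : ℕ} [Fact p.Prime] {a x : ℤ_[p]} {l : ℕ} :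
    x ∈ padicBall p a l ↔ (p : ℤ_[p]) ^ l ∣ x - a := by
  constructor
  · rintro ⟨y, rfl⟩
    exact ⟨y, by ring⟩
  · rintro ⟨y, hy⟩
    exact ⟨y, by rw [← hy]; ring⟩

theorem padicBall_eq_closedBall {p : ℕ} [Fact p.Prime] (a : ℤ_[p]) (l : ℕ) :
    padicBall p a l = Metric.closedBall a ((p : ℝ) ^ (-(l : ℤ))) := by
  ext x
  rw [mem_padicBall_iff, Metric.mem_closedBall, dist_eq_norm,
    PadicInt.norm_le_pow_iff_mem_span_pow, Ideal.mem_span_singleton]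

theorem isClopen_padicBall {p : ℕ} [Fact p.Prime] (a : ℤ_[p]) (l : ℕ) :
    IsClopen (padicBall p a l) := by
  rw [padicBall_eq_closedBall]
  have hp : (0 : ℝ) < p := by exact_mod_cast (Fact.out : p.Prime).pos
  exact IsUltrametricDist.isClopen_closedBall a (zpow_pos hp _).ne'

theorem infinite_padicBall {p : ℕ} [Fact p.Prime] (a : ℤ_[p]) (l : ℕ) :
    (padicBall p a l).Infinite := by
  have hp : (p : ℤ_[p]) ^ l ≠ 0 :=
    pow_ne_zero _ (by exact_mod_cast (Fact.out : p.Prime).ne_zero)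
  have hinj : Function.Injective fun y : ℤ_[p] => a + (p : ℤ_[p]) ^ l * y :=
    fun y z h => mul_left_cancel₀ hp (add_left_cancel h)
  refine (Set.infinite_range_of_injective hinj).mono ?_
  rintro _ ⟨y, rfl⟩
  exact ⟨y, rfl⟩

theorem mem_closure_of_forall_pow_dvd {p : ℕ} [Fact p.Prime] {S : Set ℤ_[p]} {y : ℤ_[p]}
    (h : ∀ j : ℕ, ∃ x ∈ S, (p : ℤ_[p]) ^ j ∣ x - y) : y ∈ closure S := by
  rw [Metric.mem_closure_iff]
  intro ε hε
  obtain ⟨j, hj⟩ := PadicInt.exists_pow_neg_lt p hε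
  obtain ⟨x, hx, hd⟩ := h j
  refine ⟨x, hx, lt_of_le_of_lt ?_ hj⟩
  rw [dist_comm, dist_eq_norm, PadicInt.norm_le_pow_iff_mem_span_pow, Ideal.mem_span_singleton]
  exact hd

/-- A point of a minimal subsystem containing a ball is not periodic. -/
theorem IsMinimalSubsystem.notMem_periodicPts {p : ℕ} [Fact p.Prime] {f : ℤ_[p] → ℤ_[p]}
    {S : Set ℤ_[p]} (hS : IsMinimalSubsystem f S) {a : ℤ_[p]} {l : ℕ}
    (ha : padicBall p a l ⊆ S) {x : ℤ_[p]} (hx : x ∈ S) : x ∉ Function.periodicPts f := by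
  rintro ⟨n, hn, hper⟩
  have hfin : (Set.range fun k : ℕ => f^[k] x).Finite := by
    refine ((Set.finite_lt_nat n).image fun k => f^[k] x).subset ?_
    rintro _ ⟨k, rfl⟩
    exact ⟨k % n, Nat.mod_lt _ hn, hper.iterate_mod_apply k⟩
  have hsub := hS.2.2 x hx
  rw [hfin.isClosed.closure_eq] at hsub
  exact infinite_padicBall a l (hfin.subset (ha.trans hsub))

/-- On the ball `a + 2^l ℤ_2`, the map `g` displaces each point by `2^l` times a unit. -/
def ShiftsBall (g : ℤ_[2] → ℤ_[2]) (a : ℤ_[2]) (l : ℕ) : Prop :=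
  ∀ x, 2 ^ l ∣ x - a → ∃ u, Odd u ∧ g x = x + 2 ^ l * u

/-- On the ball `a + 2^l ℤ_2`, all difference quotients of `g` are `1` modulo `4`. -/
def QuotientsOneModFour (g : ℤ_[2] → ℤ_[2]) (a : ℤ_[2]) (l : ℕ) : Prop :=
  ∀ x y, 2 ^ l ∣ x - a → 2 ^ l ∣ y - a → ∃ c, g x - g y = (x - y) * (1 + 4 * c)

/-- Doubling the iterate adds the displacements `d` and `d(1 + 4c)`, with sum `2d(1 + 2c)`: the
valuation rises by exactly one. Quotients that are merely odd would not force this. -/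
theorem iterate_two_pow_shift {g : ℤ_[2] → ℤ_[2]} {a : ℤ_[2]} {l : ℕ}
    (h₁ : ShiftsBall g a l) (h₂ : QuotientsOneModFour g a l) (j : ℕ) :
    (∀ x, 2 ^ l ∣ x - a → ∃ u, Odd u ∧ g^[2 ^ j] x = x + 2 ^ (l + j) * u) ∧
      QuotientsOneModFour g^[2 ^ j] a l := by
  induction j with
  | zero => simpa using ⟨h₁, h₂⟩
  | succ j ih =>
    obtain ⟨ih₁, ih₂⟩ := ih
    have hmaps : ∀ x, 2 ^ l ∣ x - a → 2 ^ l ∣ g^[2 ^ j] x - a := by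
      intro x hx
      obtain ⟨u, -, hu⟩ := ih₁ x hx
      rw [hu, add_sub_right_comm, pow_add, mul_assoc]
      exact dvd_add hx (dvd_mul_right _ _)
    have hsucc : ∀ x, g^[2 ^ (j + 1)] x = g^[2 ^ j] (g^[2 ^ j] x) := by
      intro x
      rw [pow_succ, mul_two, Function.iterate_add_apply]
    constructor
    · intro x hx
      obtain ⟨u, hu, hgu⟩ := ih₁ x hx
      obtain ⟨c, hc⟩ := ih₂ _ _ (hmaps x hx) hx
      refine ⟨u * (2 * c + 1), hu.mul (odd_two_mul_add_one c), ?_⟩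
      rw [hsucc, eq_add_of_sub_eq hc, hgu]
      ring
    · intro x y hx hy
      obtain ⟨c, hc⟩ := ih₂ x y hx hy
      obtain ⟨d, hd⟩ := ih₂ _ _ (hmaps x hx) (hmaps y hy)
      refine ⟨c + d + 4 * c * d, ?_⟩
      rw [hsucc, hsucc, hd, hc]
      ring

theorem even_or_odd_padicInt (x : ℤ_[2]) : Even x ∨ Odd x := by
  obtain ⟨n, ⟨hn, hmax⟩, -⟩ := PadicInt.existsUnique_mem_range (p := 2) x
  rw [PadicInt.maximalIdeal_eq_span_p, Ideal.mem_span_singleton] at hmax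
  obtain ⟨d, hd⟩ := hmax
  interval_cases n
  · exact Or.inl (even_iff_exists_two_mul.2 ⟨d, by simpa using hd⟩)
  · exact Or.inr ⟨d, by simpa [sub_eq_iff_eq_add] using hd⟩

theorem exists_iterate_congr {g : ℤ_[2] → ℤ_[2]} {a : ℤ_[2]} {l : ℕ}
    (h₁ : ShiftsBall g a l) (h₂ : QuotientsOneModFour g a l) {x y : ℤ_[2]}
    (hx : 2 ^ l ∣ x - a) (hy : 2 ^ l ∣ y - a) (j : ℕ) :
    ∃ N : ℕ, 2 ^ (l + j) ∣ g^[N] x - y := by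
  induction j with
  | zero => exact ⟨0, by simpa using dvd_sub hx hy⟩
  | succ j ih =>
    obtain ⟨N, e, he⟩ := ih
    have hNx : 2 ^ l ∣ g^[N] x - a := by
      rw [← sub_add_sub_cancel _ y, he, pow_add, mul_assoc]
      exact dvd_add (dvd_mul_right _ _) hy
    obtain ⟨u, ⟨v, hv⟩, hgu⟩ := (iterate_two_pow_shift h₁ h₂ j).1 _ hNx
    obtain hev | ⟨d, hd⟩ := even_or_odd_padicInt e
    · obtain ⟨d, hd⟩ := even_iff_exists_two_mul.1 hev
      exact ⟨N, d, by rw [he, hd]; ring⟩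
    -- An odd error is repaired by `2^j` further steps, which add `2^(l+j)` times a unit; odd plus
    -- odd is even.
    · refine ⟨2 ^ j + N, v + d + 1, ?_⟩
      rw [Function.iterate_add_apply, hgu, add_sub_right_comm, he, hd, hv]
      ring

theorem padicBall_subset_closure_orbit {g : ℤ_[2] → ℤ_[2]} {a : ℤ_[2]} {l : ℕ}
    (h₁ : ShiftsBall g a l) (h₂ : QuotientsOneModFour g a l) {x : ℤ_[2]}
    (hx : x ∈ padicBall 2 a l) :
    padicBall 2 a l ⊆ closure (Set.range fun n : ℕ => g^[n] x) := by
  intro y hy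
  rw [mem_padicBall_iff] at hx hy
  refine mem_closure_of_forall_pow_dvd fun j => ?_
  obtain ⟨N, hN⟩ := exists_iterate_congr h₁ h₂ hx hy j
  exact ⟨_, ⟨N, rfl⟩, (pow_dvd_pow _ (Nat.le_add_left j l)).trans hN⟩

theorem ShiftsBall.mapsTo {g : ℤ_[2] → ℤ_[2]} {a : ℤ_[2]} {l : ℕ} (h : ShiftsBall g a l) :
    Set.MapsTo g (padicBall 2 a l) (padicBall 2 a l) := by
  intro x hx
  rw [mem_padicBall_iff] at hx ⊢
  obtain ⟨u, -, hu⟩ := h x hx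
  rw [hu, add_sub_right_comm]
  exact dvd_add hx (dvd_mul_right _ _)

theorem isMinimalSubsystem_padicBall {g : ℤ_[2] → ℤ_[2]} {a : ℤ_[2]} {l : ℕ}
    (h₁ : ShiftsBall g a l) (h₂ : QuotientsOneModFour g a l) :
    IsMinimalSubsystem g (padicBall 2 a l) :=
  ⟨(infinite_padicBall a l).nonempty, h₁.mapsTo,
    fun _ hx => padicBall_subset_closure_orbit h₁ h₂ hx⟩

/-- The even and the odd times of a `g`-orbit are two `g^[2]`-orbits, one dense in each ball. -/
theorem isMinimalSubsystem_union_of_swap {g : ℤ_[2] → ℤ_[2]} {a b : ℤ_[2]} {l : ℕ}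
    (hab : Set.MapsTo g (padicBall 2 a l) (padicBall 2 b l))
    (hba : Set.MapsTo g (padicBall 2 b l) (padicBall 2 a l))
    (ha₁ : ShiftsBall g^[2] a l) (ha₂ : QuotientsOneModFour g^[2] a l)
    (hb₁ : ShiftsBall g^[2] b l) (hb₂ : QuotientsOneModFour g^[2] b l) :
    IsMinimalSubsystem g (padicBall 2 a l ∪ padicBall 2 b l) := by
  have hsub : ∀ x, (Set.range fun n : ℕ => (g^[2])^[n] x) ⊆ Set.range fun n : ℕ => g^[n] x := by
    rintro x _ ⟨n, rfl⟩
    exact ⟨2 * n, by simp only [Function.iterate_mul]⟩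
  have hsub' : ∀ x, (Set.range fun n : ℕ => (g^[2])^[n] (g x)) ⊆
      Set.range fun n : ℕ => g^[n] x := by
    rintro x _ ⟨n, rfl⟩
    exact ⟨2 * n + 1, by simp only [Function.iterate_mul, Function.iterate_succ_apply]⟩
  refine ⟨(infinite_padicBall a l).nonempty.mono Set.subset_union_left, ?_, ?_⟩
  · rintro x (hx | hx)
    · exact Or.inr (hab hx)
    · exact Or.inl (hba hx)
  · rintro x (hx | hx)
    · exact Set.union_subset
        ((padicBall_subset_closure_orbit ha₁ ha₂ hx).trans (closure_mono (hsub x)))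
        ((padicBall_subset_closure_orbit hb₁ hb₂ (hab hx)).trans (closure_mono (hsub' x)))
    · exact Set.union_subset
        ((padicBall_subset_closure_orbit ha₁ ha₂ (hba hx)).trans (closure_mono (hsub' x)))
        ((padicBall_subset_closure_orbit hb₁ hb₂ hx).trans (closure_mono (hsub x)))

end Dynamics

/-! ### The index `t(q)` as a 2-adic valuation. -/

section Digits

/-- Both parities are needed for the induction on `t`: while the digits alternate, `q = 2r` gives
`3q + 2 = 2(3r + 1)` with `r` odd, and `q = 2r + 1` gives `3q + 1 = 2(3r + 2)` with `r` even. It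
stops at two equal lowest digits, where `q` is 0 or 3 mod 4. -/
theorem exists_three_mul_add_eq_two_pow_mul_odd (t q : ℕ)
    (h : q.testBit t = q.testBit (t + 1)) (hne : ∀ i < t, q.testBit i ≠ q.testBit (i + 1)) :
    (Even q → ∃ w, Odd w ∧ 3 * q + 2 = 2 ^ (t + 1) * w) ∧
      (Odd q → ∃ w, Odd w ∧ 3 * q + 1 = 2 ^ (t + 1) * w) := by
  induction t generalizing q with
  | zero =>
    have hb : q % 2 = 1 ↔ q / 2 % 2 = 1 := by
      simpa [Nat.testBit_succ, Nat.testBit_zero] using h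
    constructor
    · intro hq
      rw [Nat.even_iff] at hq
      exact ⟨6 * (q / 4) + 1, ⟨3 * (q / 4), by ring⟩, by omega⟩
    · intro hq
      rw [Nat.odd_iff] at hq
      exact ⟨6 * (q / 4) + 5, ⟨3 * (q / 4) + 2, by ring⟩, by omega⟩
  | succ t ih =>
    have hb : ¬(q % 2 = 1 ↔ q / 2 % 2 = 1) := by
      simpa [Nat.testBit_succ, Nat.testBit_zero] using hne 0 t.succ_pos
    obtain ⟨ih₀, ih₁⟩ := ih (q / 2) (by simpa only [Nat.testBit_succ] using h) (by
      intro i hi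
      simpa only [Nat.testBit_succ] using hne (i + 1) (Nat.succ_lt_succ hi))
    constructor
    · intro hq
      rw [Nat.even_iff] at hq
      obtain ⟨w, hw, hw'⟩ := ih₁ (Nat.odd_iff.2 (by omega))
      exact ⟨w, hw, by rw [pow_succ' 2 (t + 1), mul_assoc, ← hw']; omega⟩
    · intro hq
      rw [Nat.odd_iff] at hq
      obtain ⟨w, hw, hw'⟩ := ih₀ (Nat.even_iff.2 (by omega))
      exact ⟨w, hw, by rw [pow_succ' 2 (t + 1), mul_assoc, ← hw']; omega⟩

theorem exists_three_mul_add_two_eq {q : ℕ} (hq : Even q) :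
    ∃ w, Odd w ∧ 3 * q + 2 = 2 ^ (tIndex q + 1) * w :=
  (exists_three_mul_add_eq_two_pow_mul_odd (tIndex q) q (Nat.find_spec (exists_testBit_eq_succ q))
    fun _ hi => Nat.find_min (exists_testBit_eq_succ q) hi).1 hq

end Digits

/-! ### Exact displacement at even points, by Lucas sequences. -/

section EvenPoints

/-- The sequence `S_0 = 0`, `S_1 = 1`, `S_{n+2} = y S_{n+1} - S_n`. -/
def lucasSeq {R : Type*} [CommRing R] (y : R) : ℕ → R
  | 0 => 0
  | 1 => 1
  | n + 2 => y * lucasSeq y (n + 1) - lucasSeq y n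

variable {R : Type*} [CommRing R]

theorem lucasSeq_add_two (y : R) (n : ℕ) :
    lucasSeq y (n + 2) = y * lucasSeq y (n + 1) - lucasSeq y n := by
  rw [lucasSeq]

theorem eval_fibPoly_add_two (x : R) (n : ℕ) :
    (fibPoly R (n + 2)).eval x = x * (fibPoly R (n + 1)).eval x + (fibPoly R n).eval x := by
  simp [fibPoly]

theorem eval_fibPoly_two_mul (x : R) (n : ℕ) :
    (fibPoly R (2 * n)).eval x = x * lucasSeq (x ^ 2 + 2) n ∧
      (fibPoly R (2 * n + 2)).eval x = x * lucasSeq (x ^ 2 + 2) (n + 1) := by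
  induction n with
  | zero => simp [fibPoly, lucasSeq]
  | succ n ih =>
    refine ⟨ih.2, ?_⟩
    have h₁ := eval_fibPoly_add_two x (2 * n)
    have h₂ := eval_fibPoly_add_two x (2 * n + 1)
    have h₃ := eval_fibPoly_add_two x (2 * n + 2)
    rw [lucasSeq_add_two]
    rw [show 2 * (n + 1) + 2 = 2 * n + 2 + 2 by ring, h₃, h₂]
    rw [ih.1, ih.2] at h₁
    rw [ih.2]
    linear_combination -h₁

/-- The second factor `2 S_{n+1} - y S_n` is the companion Lucas sequence `V_n`, so the first
identity is `S_{2n} = S_n V_n`. -/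
theorem lucasSeq_two_mul (y : R) (n : ℕ) :
    lucasSeq y (2 * n) = lucasSeq y n * (2 * lucasSeq y (n + 1) - y * lucasSeq y n) ∧
      lucasSeq y (2 * n + 1) = lucasSeq y (n + 1) ^ 2 - lucasSeq y n ^ 2 := by
  induction n with
  | zero => simp [lucasSeq]
  | succ n ih =>
    obtain ⟨h₀, h₁⟩ := ih
    have h₂ := lucasSeq_add_two y (2 * n)
    have h₃ := lucasSeq_add_two y (2 * n + 1)
    rw [show 2 * (n + 1) = 2 * n + 2 by ring, lucasSeq_add_two y n, h₃, h₂, h₁, h₀]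
    constructor <;> ring

theorem lucasSeq_cassini (y : R) (n : ℕ) :
    lucasSeq y (n + 1) ^ 2 - y * lucasSeq y n * lucasSeq y (n + 1) + lucasSeq y n ^ 2 = 1 := by
  induction n with
  | zero => simp [lucasSeq]
  | succ n ih =>
    rw [lucasSeq_add_two]
    linear_combination ih

/-- In the form `S_{2n+1} = 1 + S_n V_{n+1}`, this isolates the deviation of `F_m(x)/x` from 1. -/
theorem lucasSeq_two_mul_add_one (y : R) (n : ℕ) :
    lucasSeq y (2 * n + 1) =
      1 + lucasSeq y n * (2 * lucasSeq y (n + 2) - y * lucasSeq y (n + 1)) := by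
  rw [(lucasSeq_two_mul y n).2, lucasSeq_add_two]
  linear_combination lucasSeq_cassini y n

theorem lucasSeq_parity {y : R} (hy : Even y) (n : ℕ) :
    Even (lucasSeq y (2 * n)) ∧ Odd (lucasSeq y (2 * n + 1)) := by
  induction n with
  | zero => simp [lucasSeq]
  | succ n ih =>
    have h₂ : Even (lucasSeq y (2 * n + 2)) := by
      rw [lucasSeq_add_two]
      exact (hy.mul_right _).sub ih.1
    refine ⟨h₂, ?_⟩
    rw [show 2 * (n + 1) + 1 = 2 * n + 1 + 2 by ring, lucasSeq_add_two]
    exact (hy.mul_right _).sub_odd ih.2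

/-- The terms `S_n` alternate in parity when `y = 2c`, so exactly one of `S_{n+1}` and `c S_n` is
odd. -/
theorem exists_odd_companion {c : R} (hc : Odd c) (n : ℕ) :
    ∃ v, Odd v ∧ 2 * lucasSeq (2 * c) (n + 1) - 2 * c * lucasSeq (2 * c) n = 2 * v := by
  refine ⟨lucasSeq (2 * c) (n + 1) - c * lucasSeq (2 * c) n, ?_, by ring⟩
  obtain ⟨k, rfl | rfl⟩ := Nat.even_or_odd' n
  · obtain ⟨h₀, h₁⟩ := lucasSeq_parity (even_two_mul c) k
    exact h₁.sub_even (h₀.mul_left _)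
  · have h₁ := (lucasSeq_parity (even_two_mul c) k).2
    have h₂ := (lucasSeq_parity (even_two_mul c) (k + 1)).1
    exact h₂.sub_odd (hc.mul h₁)

/-- Each doubling of the index multiplies by `V_n`, which is 2 times an odd element. -/
theorem lucasSeq_two_pow_mul {c : R} (hc : Odd c) {w : ℕ} (hw : Odd w) (a : ℕ) :
    ∃ u, Odd u ∧ lucasSeq (2 * c) (2 ^ a * w) = 2 ^ a * u := by
  induction a with
  | zero =>
    obtain ⟨k, rfl⟩ := hw
    exact ⟨_, (lucasSeq_parity (even_two_mul c) k).2, by simp⟩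
  | succ a ih =>
    obtain ⟨u, hu, hu'⟩ := ih
    obtain ⟨v, hv, hv'⟩ := exists_odd_companion hc (2 ^ a * w)
    refine ⟨u * v, hu.mul hv, ?_⟩
    rw [pow_succ', mul_assoc, (lucasSeq_two_mul _ _).1, hv', hu']
    ring

theorem eval_fibPoly_of_even {q : ℕ} (hq : Even q) {x : R} (hx : Even x) :
    ∃ u, Odd u ∧
      (fibPoly R (10 + 12 * q)).eval x = x + x * (2 ^ (tIndex q + 2) * u) := by
  obtain ⟨w, hw, hqw⟩ := exists_three_mul_add_two_eq hq
  obtain ⟨z, rfl⟩ := even_iff_exists_two_mul.1 hx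
  have hc : Odd (2 * z ^ 2 + 1) := odd_two_mul_add_one _
  obtain ⟨u, hu, hu'⟩ := lucasSeq_two_pow_mul hc hw (tIndex q + 1)
  obtain ⟨v, hv, hv'⟩ := exists_odd_companion hc (2 ^ (tIndex q + 1) * w + 1)
  refine ⟨u * v, hu.mul hv, ?_⟩
  rw [show 10 + 12 * q = 2 * (2 * (3 * q + 2) + 1) by ring, (eval_fibPoly_two_mul _ _).1, hqw,
    show (2 * z) ^ 2 + 2 = 2 * (2 * z ^ 2 + 1) by ring, lucasSeq_two_mul_add_one, hv', hu']
  ring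

end EvenPoints

/-! ### Kernel computations modulo 4, 16 and 32. -/

section FiniteChecks

/-- The recurrence step for the values and derivatives of consecutive Fibonacci polynomials. -/
def fibStep {R : Type*} [CommRing R] (x : R) (s : (R × R) × R × R) : (R × R) × R × R :=
  ((s.1.2, x * s.1.2 + s.1.1), s.2.2, s.1.2 + x * s.2.2 + s.2.1)

/-- The recurrence step for the values of consecutive Fibonacci polynomials. -/
def fibValStep {R : Type*} [CommRing R] (x : R) (s : R × R) : R × R :=
  (s.2, x * s.2 + s.1)

variable {R S : Type*} [CommRing R] [CommRing S]

theorem map_eval_fibPoly (φ : R →+* S) (x : R) (m : ℕ) :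
    (φ ((fibPoly R m).eval x), φ ((fibPoly R (m + 1)).eval x)) =
      (fibValStep (φ x))^[m] (0, 1) := by
  induction m with
  | zero => simp [fibPoly]
  | succ m ih =>
    rw [Function.iterate_succ_apply', ← ih]
    simp [fibPoly, fibValStep]

theorem map_eval_derivative_fibPoly (φ : R →+* S) (x : R) (m : ℕ) :
    ((φ ((fibPoly R m).eval x), φ ((fibPoly R (m + 1)).eval x)),
      φ ((fibPoly R m).derivative.eval x), φ ((fibPoly R (m + 1)).derivative.eval x)) =
      (fibStep (φ x))^[m] ((0, 1), 0, 0) := by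
  induction m with
  | zero => simp [fibPoly]
  | succ m ih =>
    rw [Function.iterate_succ_apply', ← ih]
    simp [fibPoly, fibStep]

theorem iterate_add_mul_of_fixed {α : Type*} (f : α → α) (s : α) (a b : ℕ)
    (h : f^[b] s = s) (i : ℕ) : f^[a + b * i] s = f^[a] s := by
  rw [Function.iterate_add_apply, Function.iterate_mul, Function.iterate_fixed h]

/-- For even `q`, `10 + 12q` is 10 mod 24, and 10 or 34 mod 48; these periods reduce every `m` to
index 10 or 34. -/
theorem fibStep_period : ∀ x : ZMod 4, (fibStep x)^[24] ((0, 1), 0, 0) = ((0, 1), 0, 0) := by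
  decide +kernel

theorem fibValStep_period_sixteen :
    ∀ c : ZMod 16, (fibValStep (2 * c + 1))^[24] (0, 1) = (0, 1) := by
  decide +kernel

theorem fibValStep_period_thirtyTwo :
    ∀ c : ZMod 32, (fibValStep (2 * c + 1))^[48] (0, 1) = (0, 1) := by
  decide +kernel

theorem fibValStep_ten_sixteen :
    ∀ c : ZMod 16, ((fibValStep (2 * c + 1))^[10] (0, 1)).1 = 8 - (2 * c + 1) := by
  decide +kernel

theorem fibValStep_ten_thirtyTwo : ∀ c : ZMod 32,
    ((fibValStep ((fibValStep (2 * c + 1))^[10] (0, 1)).1)^[10] (0, 1)).1 = 2 * c + 1 + 16 := by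
  decide +kernel

theorem fibValStep_thirtyFour_thirtyTwo : ∀ c : ZMod 32,
    ((fibValStep ((fibValStep (2 * c + 1))^[34] (0, 1)).1)^[34] (0, 1)).1 = 2 * c + 1 + 16 := by
  decide +kernel

theorem fibStep_ten_even : ∀ c : ZMod 4,
    ((fibStep (2 * c))^[10] ((0, 1), 0, 0)).2.1 = 1 := by
  decide +kernel

theorem fibStep_ten_odd : ∀ c : ZMod 4,
    ((fibStep (((fibStep (2 * c + 1))^[10] ((0, 1), 0, 0)).1.1))^[10] ((0, 1), 0, 0)).2.1 *
      ((fibStep (2 * c + 1))^[10] ((0, 1), 0, 0)).2.1 = 1 := by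
  decide +kernel

end FiniteChecks

/-! ### Congruences for `F_m` over `ℤ_2` and the hypotheses of the criterion. -/

section Congruences

open Polynomial

theorem two_pow_dvd_sub_iff (n : ℕ) (x y : ℤ_[2]) :
    2 ^ n ∣ x - y ↔ PadicInt.toZModPow n x = PadicInt.toZModPow n y := by
  rw [← sub_eq_zero (b := PadicInt.toZModPow n y), ← map_sub, ← RingHom.mem_ker,
    PadicInt.ker_toZModPow, Ideal.mem_span_singleton, Nat.cast_ofNat]

theorem toZModPow_two_mul_add_one (n : ℕ) (c : ℤ_[2]) :
    PadicInt.toZModPow n (2 * c + 1) = 2 * PadicInt.toZModPow n c + 1 := by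
  rw [map_add, map_mul, map_ofNat, map_one]

variable {q : ℕ}

theorem eval_fibPoly_congr_sixteen (hq : Even q) {x : ℤ_[2]} (hx : Odd x) :
    2 ^ 4 ∣ (fibPoly ℤ_[2] (10 + 12 * q)).eval x - (8 - x) := by
  obtain ⟨c, rfl⟩ := hx
  obtain ⟨i, rfl⟩ := even_iff_exists_two_mul.1 hq
  have h := map_eval_fibPoly (PadicInt.toZModPow (p := 2) 4) (2 * c + 1) (10 + 12 * (2 * i))
  have hm : 10 + 12 * (2 * i) = 10 + 24 * i := by ring
  rw [hm, toZModPow_two_mul_add_one,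
    iterate_add_mul_of_fixed _ _ _ _ (fibValStep_period_sixteen _)] at h
  rw [two_pow_dvd_sub_iff, map_sub, map_ofNat, toZModPow_two_mul_add_one, hm]
  exact (congrArg Prod.fst h).trans (fibValStep_ten_sixteen _)

theorem odd_eval_fibPoly (hq : Even q) {x : ℤ_[2]} (hx : Odd x) :
    Odd ((fibPoly ℤ_[2] (10 + 12 * q)).eval x) := by
  obtain ⟨c, hc⟩ := eval_fibPoly_congr_sixteen hq hx
  obtain ⟨z, hz⟩ := hx
  exact ⟨8 * c + 3 - z, by linear_combination hc - hz⟩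

theorem eval_fibPoly_congr_thirtyTwo (hq : Even q) {x : ℤ_[2]} (hx : Odd x) :
    2 ^ 5 ∣ (fibPoly ℤ_[2] (10 + 12 * q)).eval ((fibPoly ℤ_[2] (10 + 12 * q)).eval x) -
      (x + 16) := by
  obtain ⟨m, i, hm, hmi⟩ : ∃ m i, (m = 10 ∨ m = 34) ∧ 10 + 12 * q = m + 48 * i := by
    obtain ⟨j, rfl⟩ := even_iff_exists_two_mul.1 hq
    obtain ⟨i, rfl | rfl⟩ := Nat.even_or_odd' j
    · exact ⟨10, i, Or.inl rfl, by ring⟩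
    · exact ⟨34, i, Or.inr rfl, by ring⟩
  have key : ∀ z : ℤ_[2], Odd z →
      PadicInt.toZModPow 5 ((fibPoly ℤ_[2] (10 + 12 * q)).eval z) =
        ((fibValStep (PadicInt.toZModPow 5 z))^[m] (0, 1)).1 := by
    rintro z ⟨c, rfl⟩
    have h := map_eval_fibPoly (PadicInt.toZModPow (p := 2) 5) (2 * c + 1) (10 + 12 * q)
    rw [toZModPow_two_mul_add_one, hmi,
      iterate_add_mul_of_fixed _ _ _ _ (fibValStep_period_thirtyTwo _)] at h
    rw [toZModPow_two_mul_add_one, hmi]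
    exact congrArg Prod.fst h
  rw [two_pow_dvd_sub_iff, key _ (odd_eval_fibPoly hq hx), key _ hx, map_add, map_ofNat]
  obtain ⟨c, rfl⟩ := hx
  rw [toZModPow_two_mul_add_one]
  obtain rfl | rfl := hm
  · exact fibValStep_ten_thirtyTwo _
  · exact fibValStep_thirtyFour_thirtyTwo _

theorem map_eval_fibPoly_four (hq : Even q) (x : ℤ_[2]) :
    PadicInt.toZModPow 2 ((fibPoly ℤ_[2] (10 + 12 * q)).eval x) =
        ((fibStep (PadicInt.toZModPow 2 x))^[10] ((0, 1), 0, 0)).1.1 ∧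
      PadicInt.toZModPow 2 ((fibPoly ℤ_[2] (10 + 12 * q)).derivative.eval x) =
        ((fibStep (PadicInt.toZModPow 2 x))^[10] ((0, 1), 0, 0)).2.1 := by
  obtain ⟨i, rfl⟩ := even_iff_exists_two_mul.1 hq
  have h := map_eval_derivative_fibPoly (PadicInt.toZModPow (p := 2) 2) x (10 + 12 * (2 * i))
  have hm : 10 + 12 * (2 * i) = 10 + 24 * i := by ring
  rw [hm, iterate_add_mul_of_fixed _ _ _ _ (fibStep_period _)] at h
  rw [hm]
  exact ⟨congrArg (fun s => s.1.1) h, congrArg (fun s => s.2.1) h⟩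

theorem derivative_congr_of_even (hq : Even q) {x : ℤ_[2]} (hx : Even x) :
    2 ^ 2 ∣ (fibPoly ℤ_[2] (10 + 12 * q)).derivative.eval x - 1 := by
  obtain ⟨c, rfl⟩ := even_iff_exists_two_mul.1 hx
  rw [two_pow_dvd_sub_iff, (map_eval_fibPoly_four hq _).2, map_mul, map_ofNat, map_one]
  exact fibStep_ten_even _

theorem derivative_mul_congr_of_odd (hq : Even q) {x : ℤ_[2]} (hx : Odd x) :
    2 ^ 2 ∣ (fibPoly ℤ_[2] (10 + 12 * q)).derivative.eval
        ((fibPoly ℤ_[2] (10 + 12 * q)).eval x) *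
      (fibPoly ℤ_[2] (10 + 12 * q)).derivative.eval x - 1 := by
  obtain ⟨c, rfl⟩ := hx
  rw [two_pow_dvd_sub_iff, map_mul, (map_eval_fibPoly_four hq _).2, (map_eval_fibPoly_four hq _).2,
    (map_eval_fibPoly_four hq _).1, toZModPow_two_mul_add_one, map_one]
  exact fibStep_ten_odd _

/-- Second-order Taylor expansion: the remainder `k(x - y)^2` contributes a multiple of 4 to the
quotient. -/
theorem exists_eval_sub_eval_eq {R : Type*} [CommRing R] (f : R[X]) {x y : R} (h : 4 ∣ x - y) :
    ∃ c, f.eval x - f.eval y = (x - y) * (f.derivative.eval y + 4 * c) := by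
  obtain ⟨d, hd⟩ := h
  obtain ⟨k, hk⟩ := f.binomExpansion y (x - y)
  rw [add_sub_cancel] at hk
  exact ⟨d * k, by linear_combination hk + (x - y) * k * hd⟩

theorem four_dvd_sub_of_two_pow_dvd {R : Type*} [CommRing R] {l : ℕ} (hl : 2 ≤ l) {x y a : R}
    (hx : 2 ^ l ∣ x - a) (hy : 2 ^ l ∣ y - a) : 4 ∣ x - y := by
  have h := (pow_dvd_pow (2 : R) hl).trans (dvd_sub hx hy)
  rw [sub_sub_sub_cancel_right] at h
  exact (by norm_num : (4 : R) = 2 ^ 2) ▸ h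

theorem quotientsOneModFour_of_even (hq : Even q) {a : ℤ_[2]} (ha : Even a) {l : ℕ} (hl : 2 ≤ l) :
    QuotientsOneModFour (fun x => (fibPoly ℤ_[2] (10 + 12 * q)).eval x) a l := by
  intro x y hx hy
  obtain ⟨c, hc⟩ := exists_eval_sub_eval_eq (fibPoly ℤ_[2] (10 + 12 * q))
    (four_dvd_sub_of_two_pow_dvd hl hx hy)
  have hye : Even y := by
    have : (2 : ℤ_[2]) ∣ y - a := (dvd_pow_self 2 (by omega)).trans hy
    simpa using (even_iff_two_dvd.2 this).add ha
  obtain ⟨d, hd⟩ := derivative_congr_of_even hq hye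
  exact ⟨c + d, by linear_combination hc + (x - y) * hd⟩

theorem odd_of_two_pow_dvd_sub {R : Type*} [CommRing R] {l : ℕ} (hl : l ≠ 0) {x a : R}
    (ha : Odd a) (hx : 2 ^ l ∣ x - a) : Odd x := by
  have : (2 : R) ∣ x - a := (dvd_pow_self 2 hl).trans hx
  simpa using (even_iff_two_dvd.2 this).add_odd ha

theorem quotientsOneModFour_of_odd (hq : Even q) {a : ℤ_[2]} (ha : Odd a) {l : ℕ} (hl : 2 ≤ l) :
    QuotientsOneModFour (fun x => (fibPoly ℤ_[2] (10 + 12 * q)).eval x)^[2] a l := by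
  intro x y hx hy
  have h4 := four_dvd_sub_of_two_pow_dvd hl hx hy
  obtain ⟨c, hc⟩ := exists_eval_sub_eval_eq (fibPoly ℤ_[2] (10 + 12 * q)) h4
  obtain ⟨e, he⟩ := exists_eval_sub_eval_eq (fibPoly ℤ_[2] (10 + 12 * q))
    (h4.trans (Dvd.intro _ hc.symm))
  obtain ⟨d, hd⟩ := derivative_mul_congr_of_odd hq (odd_of_two_pow_dvd_sub (by omega) ha hy)
  simp only [Function.iterate_succ, Function.iterate_zero, Function.comp_apply, id]
  generalize (fibPoly ℤ_[2] (10 + 12 * q)).derivative.eval y = D at *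
  generalize (fibPoly ℤ_[2] (10 + 12 * q)).derivative.eval
    ((fibPoly ℤ_[2] (10 + 12 * q)).eval y) = E at *
  -- Chain rule modulo 4: expand `(D + 4c)(E + 4e)` with `E D = 1 + 4d`.
  refine ⟨d + E * c + e * D + 4 * e * c, ?_⟩
  rw [he, hc]
  linear_combination (x - y) * hd

theorem shiftsBall_of_odd (hq : Even q) {a : ℤ_[2]} (ha : Odd a) :
    ShiftsBall (fun x => (fibPoly ℤ_[2] (10 + 12 * q)).eval x)^[2] a 4 := by
  intro x hx
  obtain ⟨c, hc⟩ := eval_fibPoly_congr_thirtyTwo hq (odd_of_two_pow_dvd_sub (by norm_num) ha hx)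
  refine ⟨2 * c + 1, odd_two_mul_add_one c, ?_⟩
  simp only [Function.iterate_succ, Function.iterate_zero, Function.comp_apply, id]
  linear_combination hc

theorem mapsTo_padicBall_of_odd (hq : Even q) {a b : ℤ_[2]} (ha : Odd a) (hab : a + b = 8) :
    Set.MapsTo (fun x => (fibPoly ℤ_[2] (10 + 12 * q)).eval x)
      (padicBall 2 a 4) (padicBall 2 b 4) := by
  intro x hx
  rw [mem_padicBall_iff, Nat.cast_ofNat] at hx ⊢
  obtain ⟨c, hc⟩ := eval_fibPoly_congr_sixteen hq (odd_of_two_pow_dvd_sub (by norm_num) ha hx)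
  obtain ⟨d, hd⟩ := hx
  exact ⟨c - d, by linear_combination hc - hd - hab⟩

theorem shiftsBall_of_even (hq : Even q) {n : ℕ} (hn : 1 ≤ n) {k : ℤ_[2]} :
    ShiftsBall (fun x => (fibPoly ℤ_[2] (10 + 12 * q)).eval x)
      ((1 + 2 * k) * 2 ^ n) (n + tIndex q + 2) := by
  rintro x ⟨d, hd⟩
  have hx : x = 2 ^ n * (2 * (k + 2 ^ (tIndex q + 1) * d) + 1) := by
    linear_combination hd
  have hxe : Even x := by
    rw [hx]
    exact (even_two.pow_of_ne_zero (by omega)).mul_right _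
  obtain ⟨u, hu, hfu⟩ := eval_fibPoly_of_even hq hxe
  refine ⟨_, (odd_two_mul_add_one (k + 2 ^ (tIndex q + 1) * d)).mul hu, ?_⟩
  beta_reduce
  rw [hfu]
  linear_combination 2 ^ (tIndex q + 2) * u * hx

end Congruences

/-! ### Minimality, disjointness and covering of the components. -/

section Decomposition

theorem isMinimalSubsystem_componentA {q : ℕ} (hq : Even q) (k : ℕ) :
    IsMinimalSubsystem (fun x : ℤ_[2] => (fibPoly ℤ_[2] (10 + 12 * q)).eval x)
      (componentA k) := by
  have ha : Odd (1 + 4 * (k : ℤ_[2])) := ⟨2 * k, by ring⟩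
  have hb : Odd (7 - 4 * (k : ℤ_[2])) := ⟨3 - 2 * k, by ring⟩
  exact isMinimalSubsystem_union_of_swap
    (mapsTo_padicBall_of_odd hq ha (by ring)) (mapsTo_padicBall_of_odd hq hb (by ring))
    (shiftsBall_of_odd hq ha) (quotientsOneModFour_of_odd hq ha (by norm_num))
    (shiftsBall_of_odd hq hb) (quotientsOneModFour_of_odd hq hb (by norm_num))

theorem isMinimalSubsystem_componentM {q : ℕ} (hq : Even q) {n : ℕ} (hn : 1 ≤ n) (k : ℕ) :
    IsMinimalSubsystem (fun x : ℤ_[2] => (fibPoly ℤ_[2] (10 + 12 * q)).eval x)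
      (componentM (tIndex q) n k) :=
  isMinimalSubsystem_padicBall (shiftsBall_of_even hq hn)
    (quotientsOneModFour_of_even hq ((even_two.pow_of_ne_zero (by omega)).mul_left _) (by omega))

theorem isFiniteUnionOfBalls_padicBall {p : ℕ} [Fact p.Prime] (a : ℤ_[p]) (l : ℕ) :
    IsFiniteUnionOfBalls p (padicBall p a l) :=
  ⟨{(a, l)}, by simp⟩

theorem IsFiniteUnionOfBalls.union {p : ℕ} [Fact p.Prime] {S T : Set ℤ_[p]}
    (hS : IsFiniteUnionOfBalls p S) (hT : IsFiniteUnionOfBalls p T) :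
    IsFiniteUnionOfBalls p (S ∪ T) := by
  classical
  obtain ⟨s, rfl⟩ := hS
  obtain ⟨t, rfl⟩ := hT
  exact ⟨s ∪ t, (Finset.set_biUnion_union s t _).symm⟩

theorem mem_componentA_iff (k : ℕ) (x : ℤ_[2]) :
    x ∈ componentA k ↔ PadicInt.toZModPow 4 x = 1 + 4 * (k : ZMod 16) ∨
      PadicInt.toZModPow 4 x = 7 - 4 * (k : ZMod 16) := by
  have h₁ : PadicInt.toZModPow 4 (1 + 4 * (k : ℤ_[2])) = 1 + 4 * (k : ZMod (2 ^ 4)) := by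
    rw [map_add, map_mul, map_ofNat, map_one, map_natCast]
  have h₂ : PadicInt.toZModPow 4 (7 - 4 * (k : ℤ_[2])) = 7 - 4 * (k : ZMod (2 ^ 4)) := by
    rw [map_sub, map_mul, map_ofNat, map_ofNat, map_natCast]
  rw [componentA, Set.mem_union, mem_padicBall_iff, mem_padicBall_iff, Nat.cast_ofNat,
    two_pow_dvd_sub_iff, two_pow_dvd_sub_iff, h₁, h₂]

theorem disjoint_componentA {k k' : Fin 4} (h : k ≠ k') :
    Disjoint (componentA k) (componentA k') := by
  rw [Set.disjoint_left]
  intro x hx hx'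
  rw [mem_componentA_iff] at hx hx'
  have key : ∀ (k k' : Fin 4) (z : ZMod 16), k ≠ k' →
      (z = 1 + 4 * ((k : ℕ) : ZMod 16) ∨ z = 7 - 4 * ((k : ℕ) : ZMod 16)) →
      (z = 1 + 4 * ((k' : ℕ) : ZMod 16) ∨ z = 7 - 4 * ((k' : ℕ) : ZMod 16)) → False := by
    decide +kernel
  exact key k k' _ h hx hx'

theorem exists_mem_componentA {x : ℤ_[2]} (hx : Odd x) : ∃ k : Fin 4, x ∈ componentA k := by
  have key : ∀ c : ZMod 16, ∃ k : Fin 4, 2 * c + 1 = 1 + 4 * ((k : ℕ) : ZMod 16) ∨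
      2 * c + 1 = 7 - 4 * ((k : ℕ) : ZMod 16) := by
    decide +kernel
  obtain ⟨c, rfl⟩ := hx
  obtain ⟨k, hk⟩ := key (PadicInt.toZModPow 4 c)
  refine ⟨k, ?_⟩
  rw [mem_componentA_iff, toZModPow_two_mul_add_one]
  exact hk

theorem odd_of_mem_componentA {k : ℕ} {x : ℤ_[2]} (hx : x ∈ componentA k) : Odd x := by
  rcases hx with ⟨y, rfl⟩ | ⟨y, rfl⟩
  · exact ⟨2 * k + 8 * y, by push_cast; ring⟩
  · exact ⟨3 - 2 * k + 8 * y, by push_cast; ring⟩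

theorem exists_of_mem_componentM {t n k : ℕ} {x : ℤ_[2]} (hx : x ∈ componentM t n k) :
    ∃ y : ℤ_[2], x = 2 ^ n * (2 * (k + 2 ^ (t + 1) * y) + 1) := by
  obtain ⟨y, rfl⟩ := hx
  exact ⟨y, by push_cast; ring⟩

theorem not_even_of_odd_padicInt {x : ℤ_[2]} (ho : Odd x) : ¬Even x := by
  intro he
  have h : (2 : ℤ_[2]) ∣ 1 := by
    obtain ⟨c, rfl⟩ := ho
    exact (dvd_add_right (dvd_mul_right 2 c)).1 (even_iff_two_dvd.1 he)
  exact PadicInt.prime_p.not_dvd_one (by exact_mod_cast h)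

theorem even_of_mem_componentM {t n k : ℕ} (hn : 1 ≤ n) {x : ℤ_[2]}
    (hx : x ∈ componentM t n k) : Even x := by
  obtain ⟨y, rfl⟩ := exists_of_mem_componentM hx
  exact (even_two.pow_of_ne_zero (by omega)).mul_right _

theorem two_pow_mul_odd_inj {n n' : ℕ} {u u' : ℤ_[2]} (hu : Odd u) (hu' : Odd u')
    (h : 2 ^ n * u = 2 ^ n' * u') : n = n' ∧ u = u' := by
  have h2 : ∀ m : ℕ, (2 : ℤ_[2]) ^ m ≠ 0 := fun m => pow_ne_zero _ two_ne_zero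
  have aux : ∀ {n d : ℕ} {u u' : ℤ_[2]}, Odd u → 2 ^ n * u = 2 ^ (n + d) * u' → d = 0 := by
    intro n d u u' hu h
    rw [pow_add, mul_assoc] at h
    by_contra hd
    rw [mul_left_cancel₀ (h2 n) h] at hu
    exact not_even_of_odd_padicInt hu ((even_two.pow_of_ne_zero hd).mul_right _)
  obtain rfl : n = n' := by
    rcases le_total n n' with hle | hle <;> obtain ⟨d, rfl⟩ := Nat.exists_eq_add_of_le hle
    · rw [aux hu h, add_zero]
    · rw [aux hu' h.symm, add_zero]
  exact ⟨rfl, mul_left_cancel₀ (h2 n) h⟩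

theorem eq_of_two_pow_dvd_sub {l k k' : ℕ} (hk : k < 2 ^ l) (hk' : k' < 2 ^ l)
    (h : 2 ^ l ∣ (k : ℤ_[2]) - k') : k = k' := by
  rw [two_pow_dvd_sub_iff, map_natCast, map_natCast, ZMod.natCast_eq_natCast_iff'] at h
  rwa [Nat.mod_eq_of_lt hk, Nat.mod_eq_of_lt hk'] at h

theorem eq_of_mem_componentM {t n n' k k' : ℕ} (hk : k < 2 ^ (t + 1)) (hk' : k' < 2 ^ (t + 1))
    {x : ℤ_[2]} (hx : x ∈ componentM t n k) (hx' : x ∈ componentM t n' k') :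
    n = n' ∧ k = k' := by
  obtain ⟨y, rfl⟩ := exists_of_mem_componentM hx
  obtain ⟨z, hz⟩ := exists_of_mem_componentM hx'
  obtain ⟨hn, hu⟩ := two_pow_mul_odd_inj (odd_two_mul_add_one _) (odd_two_mul_add_one _) hz
  have h := mul_left_cancel₀ two_ne_zero (add_right_cancel hu)
  exact ⟨hn, eq_of_two_pow_dvd_sub hk hk' ⟨z - y, by linear_combination h⟩⟩

theorem exists_mem_componentM (t : ℕ) {x : ℤ_[2]} (hx : Even x) (h0 : x ≠ 0) :
    ∃ n k : ℕ, 1 ≤ n ∧ k < 2 ^ (t + 1) ∧ x ∈ componentM t n k := by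
  have hu : Odd (PadicInt.unitCoeff h0 : ℤ_[2]) := by
    refine (even_or_odd_padicInt _).resolve_left fun he => ?_
    have h : ((2 : ℕ) : ℤ_[2]) ∣ PadicInt.unitCoeff h0 := by
      simpa using even_iff_two_dvd.1 he
    exact PadicInt.prime_p.not_isUnit (isUnit_of_dvd_unit h (PadicInt.unitCoeff h0).isUnit)
  have hspec := PadicInt.unitCoeff_spec h0
  obtain ⟨c, hc⟩ := hu
  -- With unit part `2c + 1`, the index `k` is the residue of `c` modulo `2^(t+1)`.
  refine ⟨x.valuation, PadicInt.appr c (t + 1), ?_, PadicInt.appr_lt _ _, ?_⟩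
  · by_contra hn
    rw [not_le, Nat.lt_one_iff] at hn
    rw [hn, pow_zero, mul_one] at hspec
    exact not_even_of_odd_padicInt ⟨c, hspec.trans hc⟩ hx
  · have happr := PadicInt.appr_spec (t + 1) c
    rw [Ideal.mem_span_singleton, Nat.cast_ofNat] at happr
    obtain ⟨d, hd⟩ := happr
    refine ⟨d, ?_⟩
    rw [Nat.cast_ofNat] at hspec ⊢
    rw [hc] at hspec
    linear_combination hspec + 2 * 2 ^ x.valuation * hd

end Decomposition

theorem mainTheorem10 (q : ℕ) (hq : Even q) :
    Function.IsFixedPt (fun x : ℤ_[2] => (fibPoly ℤ_[2] (10 + 12 * q)).eval x) 0 ∧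
    IsMinimalDecomposition 2 (fun x : ℤ_[2] => (fibPoly ℤ_[2] (10 + 12 * q)).eval x)
      {0}
      (Sum.elim
        (fun k : Fin 4 => componentA k)
        (fun nk : {n : ℕ // 1 ≤ n} × Fin (2 ^ (tIndex q + 1)) =>
          componentM (tIndex q) nk.1 nk.2))
      ∅ := by
  have hfix : Function.IsFixedPt (fun x : ℤ_[2] => (fibPoly ℤ_[2] (10 + 12 * q)).eval x) 0 := by
    obtain ⟨u, -, hu⟩ := eval_fibPoly_of_even hq (R := ℤ_[2]) Even.zero
    simpa [Function.IsFixedPt] using hu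
  have hcover : ∀ x : ℤ_[2], x ≠ 0 → (∃ k : Fin 4, x ∈ componentA k) ∨
      ∃ nk : {n : ℕ // 1 ≤ n} × Fin (2 ^ (tIndex q + 1)),
        x ∈ componentM (tIndex q) nk.1 nk.2 := by
    intro x h0
    rcases even_or_odd_padicInt x with hx | hx
    · obtain ⟨n, k, hn, hk, hmem⟩ := exists_mem_componentM (tIndex q) hx h0
      exact Or.inr ⟨(⟨n, hn⟩, ⟨k, hk⟩), hmem⟩
    · exact Or.inl (exists_mem_componentA hx)
  have hAM : ∀ (k n k' : ℕ), 1 ≤ n → Disjoint (componentA k) (componentM (tIndex q) n k') := by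
    intro k n k' hn
    exact Set.disjoint_left.2 fun x hx hx' =>
      not_even_of_odd_padicInt (odd_of_mem_componentA hx) (even_of_mem_componentM hn hx')
  refine ⟨hfix, ?_⟩
  constructor
  case finite_P => exact Set.finite_singleton 0
  case P_eq =>
    refine Set.Subset.antisymm ?_ ?_
    · rintro _ rfl
      exact ⟨1, one_pos, hfix⟩
    · intro x hx
      by_contra h0
      obtain ⟨k, hk⟩ | ⟨⟨⟨n, hn⟩, k⟩, hk⟩ := hcover x h0
      · exact (isMinimalSubsystem_componentA hq k).notMem_periodicPts
          Set.subset_union_left hk hx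
      · exact (isMinimalSubsystem_componentM hq hn k).notMem_periodicPts subset_rfl hk hx
  case countable => infer_instance
  case isClopen =>
    rintro (k | nk)
    · exact (isClopen_padicBall _ _).union (isClopen_padicBall _ _)
    · exact isClopen_padicBall _ _
  case isFiniteUnionOfBalls =>
    rintro (k | nk)
    · exact (isFiniteUnionOfBalls_padicBall _ _).union (isFiniteUnionOfBalls_padicBall _ _)
    · exact isFiniteUnionOfBalls_padicBall _ _
  case isMinimalSubsystem =>
    rintro (k | ⟨⟨n, hn⟩, k⟩)
    · exact isMinimalSubsystem_componentA hq k
    · exact isMinimalSubsystem_componentM hq hn k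
  case basin => exact fun x hx => hx.elim
  case disjoint_M =>
    rintro (k | ⟨⟨n, hn⟩, k⟩) (k' | ⟨⟨n', hn'⟩, k'⟩) hne
    · exact disjoint_componentA fun h => hne (congrArg Sum.inl h)
    · exact hAM _ _ _ hn'
    · exact (hAM _ _ _ hn).symm
    · refine Set.disjoint_left.2 fun x hx hx' => hne ?_
      obtain ⟨h₁, h₂⟩ := eq_of_mem_componentM k.2 k'.2 hx hx'
      exact congrArg Sum.inr (Prod.ext (Subtype.ext h₁) (Fin.ext h₂))
  case disjoint_P_M =>
    rintro (k | ⟨⟨n, hn⟩, k⟩) <;> rw [Set.disjoint_singleton_left]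
    · exact fun h => not_even_of_odd_padicInt (odd_of_mem_componentA h) Even.zero
    · intro h
      obtain ⟨y, hy⟩ := exists_of_mem_componentM h
      have hu := (mul_eq_zero.1 hy.symm).resolve_left (pow_ne_zero _ two_ne_zero)
      exact not_even_of_odd_padicInt ⟨_, hu.symm⟩ Even.zero
  case disjoint_P_B => exact Set.disjoint_empty _
  case disjoint_M_B => exact fun i => Set.disjoint_empty _
  case union_eq =>
    rw [Set.union_empty, Set.eq_univ_iff_forall]
    intro x
    by_cases h0 : x = 0
    · exact Or.inl h0
    · refine Or.inr (Set.mem_iUnion.2 ?_)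
      obtain ⟨k, hk⟩ | ⟨nk, hk⟩ := hcover x h0
      · exact ⟨Sum.inl k, hk⟩
      · exact ⟨Sum.inr nk, hk⟩
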